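/- **Theorem 4.5 (gluing inflation factorization systems).** *Setting.* All categories are additive. Let $\mathcal A,\mathcal B,\mathcal C$ be extriangulated categories (in the sense of Nakaoka–Palu), each with a negative first extension structure: an additive bifunctor $\mathbb E^{-1}\colon\mathscr C^{op}\times\mathscr C\to Ab$ together with, for each $\delta\in\mathbb E(Z,A)$, natural transformations $\mathbb E^{-1}(-,Z)\to\mathscr C(-,A)$ and $\mathbb E^{-1}(A,-)\to\mathscr C(Z,-)$ such that for every $\mathbb E$-triangle $A\xrightarrow{f}B\xrightarrow{g}Z\overset{\delta}{\dashrightarrow}$ and every $W$ the sequences $$\mathbb E^{-1}(W,A)\to\mathbb E^{-1}(W,B)\to\mathbb E^{-1}(W,Z)\to\mathscr C(W,A)\to\mathscr C(W,B),$$ $$\mathbb E^{-1}(Z,W)\to\mathbb E^{-1}(B,W)\to\mathbb E^{-1}(A,W)\to\mathscr C(Z,W)\to\mathscr C(B,W)$$ are exact. Assume that the three structures are *balanced*, i.e. $\mathbb E^{-1}(-,P)=0$ for every projective object $P$ ($P$ is projective if every morphism $P\to Z$ factors through $y$ for every conflation $A\to B\xrightarrow{y}Z$), and that $\mathcal B$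 has enough projectives: every $Z\in\mathcal B$ admits a conflation $A\to P\to Z$ with $P$ projective. *Functors.* A morphism is *compatible* if it is an isomorphism whenever it is both an inflation and a deflation. A sequence $A\xrightarrow{f}B\xrightarrow{g}Z$ is *left exact* if $g=g_2g_1$ with $A\xrightarrow{f}B\xrightarrow{g_1}K$ a conflation and $g_2$ a compatible inflation; it is *right exact* if $f=f_2f_1$ with $K\xrightarrow{f_2}B\xrightarrow{g}Z$ a conflation and $f_1$ a compatible deflation. A four-term sequence $A\xrightarrow{f}B\xrightarrow{g}Z\xrightarrow{h}D$ is *left exact* (resp. *right exact*) if there are conflations $A\xrightarrow{f}B\xrightarrow{g_1}K$ and $K\xrightarrow{g_2}Z\xrightarrow{h}D$ with $g=g_2g_1$ and $g_2$ (resp. $g_1$) compatible. An additive functor is *left* (resp. *right*) *exact* if it preserves compatible morphisms and left (resp. right) exact sequences. An additive functor $F$ is *exact* if there is a natural transformation $\eta\colon\mathbb E(-,-)\to\mathbb E(F-,F-)$ such that $F$ sends each $\mathbb E$-triangle with extension $\delta$ to an $\mathbb E$-triangle with extension $\eta(\delta)$. *Recollement.* Suppose given a recollement of $\mathcal B$ relative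 to $\mathcal A$ and $\mathcal C$: exact functors $i_*\colon\mathcal A\to\mathcal B$, $j^*\colon\mathcal B\to\mathcal C$, right exact functors $i^*\colon\mathcal B\to\mathcal A$, $j_!\colon\mathcal C\to\mathcal B$ and left exact functors $i^!\colon\mathcal B\to\mathcal A$, $j_*\colon\mathcal C\to\mathcal B$ such that $(i^*,i_*,i^!)$ and $(j_!,j^*,j_*)$ are adjoint triples; $\operatorname{Im}i_*=\operatorname{Ker}j^*$ (essential image); $i_*,j_!,j_*$ are fully faithful; and for each $X\in\mathcal B$ there are $A,A'\in\mathcal A$, a left exact four-term sequence $i_*i^!X\to X\to j_*j^*X\to i_*A$ and a right exact four-term sequence $i_*A'\to j_!j^*X\to X\to i_*i^*X$ in which the morphisms into and out of $X$ are the adjunction morphisms. *Inflation factorization systems.* For inflations $l,r$ write $l\perp r$ if $\mathscr C(\operatorname{cone}l,\operatorname{cone}r)=0$ and $\mathbb E^{-1}(\operatorname{cone}l,\operatorname{cone}r)=0$. For a class $\mathcal I$ of inflations, $\mathcal I^\perp$ (resp. ${}^\perp\mathcal I$) is the class of inflations $f$ with $g\perp f$ (resp. $f\perp g$) for all $g\in\mathcal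 I$. A pair $(\mathcal L,\mathcal R)$ of classes of inflations is an *inflation factorization system* if every inflation $f$ factors as $f=rl$ with $l\in\mathcal L$, $r\in\mathcal R$, and $\mathcal L={}^\perp\mathcal R$, $\mathcal L^\perp=\mathcal R$. *Statement.* Let $(\mathcal E_1,\mathcal M_1)$ and $(\mathcal E_2,\mathcal M_2)$ be inflation factorization systems in $\mathcal A$ and $\mathcal C$, respectively, and set $$\mathcal E=\{f\text{ an inflation in }\mathcal B\mid i^*f\in\mathcal E_1,\ j^*f\in\mathcal E_2\},\qquad \mathcal M=\{g\text{ an inflation in }\mathcal B\mid i^!g\in\mathcal M_1,\ j^*g\in\mathcal M_2\}.$$ If $i^*$ and $i^!$ are exact and $i^!$ preserves projective objects, then $(\mathcal E,\mathcal M)$ is an inflation factorization system in $\mathcal B$. -/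

import Mathlib

open CategoryTheory CategoryTheory.Limits Opposite

namespace Extri

/-- Biadditive functors `Cᵒᵖ × C ⥤ Ab`, in curried form. -/
structure AdditiveBifunctor.{w, v, u} (C : Type u) [Category.{v} C] [Preadditive C] where
  toFunctor : Cᵒᵖ ⥤ C ⥤ AddCommGrpCat.{w}
  additive_left : toFunctor.Additive
  additive_right : ∀ X : Cᵒᵖ, (toFunctor.obj X).Additive

namespace AdditiveBifunctor

universe w v u

variable {C : Type u} [Category.{v} C] [Preadditive C] (E : AdditiveBifunctor.{w} C)

/-- The abelian group `E(X, A)`. -/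
abbrev grp (X A : C) : Type w := (E.toFunctor.obj (op X)).obj A

/-- The map `a_* : E(X, A) → E(X, A')` induced by `a : A ⟶ A'`. -/
def push {X A A' : C} (a : A ⟶ A') : E.grp X A →+ E.grp X A' :=
  ((E.toFunctor.obj (op X)).map a).hom

/-- The map `c^* : E(X, A) → E(X', A)` induced by `c : X' ⟶ X`. -/
def pull {X X' A : C} (c : X' ⟶ X) : E.grp X A →+ E.grp X' A :=
  ((E.toFunctor.map c.op).app A).hom

end AdditiveBifunctor

/-- Sequences `A ⟶ B ⟶ Z` with fixed end terms. -/
structure Seq.{v, u} {C : Type u} [Category.{v} C] (A Z : C) where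
  mid : C
  fst : A ⟶ mid
  snd : mid ⟶ Z

/-- Two sequences with the same end terms are equivalent if there is an isomorphism between
the middle terms that is compatible with the identities of the end terms. -/
instance seqSetoid.{v, u} {C : Type u} [Category.{v} C] (A Z : C) : Setoid (Seq A Z) where
  r S S' := ∃ b : S.mid ≅ S'.mid, S.fst ≫ b.hom = S'.fst ∧ b.hom ≫ S'.snd = S.snd
  iseqv :=
    { refl := fun S => ⟨Iso.refl _, by simp, by simp⟩
      symm := by
        rintro S S' ⟨b, h₁, h₂⟩
        exact ⟨b.symm, by simp [← h₁], by simp [← h₂]⟩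
      trans := by
        rintro S S' S'' ⟨b, h₁, h₂⟩ ⟨b', h₁', h₂'⟩
        exact ⟨b ≪≫ b', by simp [← h₁', ← h₁], by simp [← h₂, ← h₂']⟩ }

/-- The equivalence class of the sequence `x : A ⟶ B`, `y : B ⟶ Z`. -/
def seqClass.{v, u} {C : Type u} [Category.{v} C] {A B Z : C} (x : A ⟶ B) (y : B ⟶ Z) :
    Quotient (seqSetoid A Z) :=
  Quotient.mk _ ⟨B, x, y⟩

/-- An extriangulated structure (in the sense of Nakaoka and Palu) on an additive category:
a biadditive functor `E` and an additive realization `s` of it that satisfy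
(ET3), (ET3)ᵒᵖ, (ET4) and (ET4)ᵒᵖ. -/
class Extriangulated.{w, v, u} (C : Type u) [Category.{v} C] [Preadditive C]
    [HasZeroObject C] [HasBinaryBiproducts C] where
  /-- The biadditive functor of extensions. -/
  E : AdditiveBifunctor.{w} C
  /-- The correspondence that sends an extension to an equivalence class of sequences. -/
  s : ∀ {Z A : C}, E.grp Z A → Quotient (seqSetoid A Z)
  /-- `s` is a realization: morphisms of extensions lift to the middle terms. -/
  realization : ∀ {A B Z A' B' Z' : C} (x : A ⟶ B) (y : B ⟶ Z) (x' : A' ⟶ B') (y' : B' ⟶ Z')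
    (δ : E.grp Z A) (δ' : E.grp Z' A'), s δ = seqClass x y → s δ' = seqClass x' y' →
    ∀ (a : A ⟶ A') (c : Z ⟶ Z'), E.push a δ = E.pull c δ' →
      ∃ b : B ⟶ B', x ≫ b = a ≫ x' ∧ y ≫ c = b ≫ y'
  /-- The zero extension is realized by the split sequence. -/
  s_zero : ∀ Z A : C, s (0 : E.grp Z A) = seqClass (biprod.inl : A ⟶ A ⊞ Z) biprod.snd
  /-- The realization of a direct sum of extensions is the direct sum of the realizations. -/
  s_sum : ∀ {A B Z A' B' Z' : C} (x : A ⟶ B) (y : B ⟶ Z) (x' : A' ⟶ B') (y' : B' ⟶ Z')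
    (δ : E.grp Z A) (δ' : E.grp Z' A'), s δ = seqClass x y → s δ' = seqClass x' y' →
    s (E.pull (biprod.fst : Z ⊞ Z' ⟶ Z) (E.push (biprod.inl : A ⟶ A ⊞ A') δ) +
        E.pull (biprod.snd : Z ⊞ Z' ⟶ Z') (E.push (biprod.inr : A' ⟶ A ⊞ A') δ')) =
      seqClass (biprod.map x x') (biprod.map y y')
  /-- (ET3) -/
  et3 : ∀ {A B Z A' B' Z' : C} (x : A ⟶ B) (y : B ⟶ Z) (x' : A' ⟶ B') (y' : B' ⟶ Z')
    (δ : E.grp Z A) (δ' : E.grp Z' A'), s δ = seqClass x y → s δ' = seqClass x' y' →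
    ∀ (a : A ⟶ A') (b : B ⟶ B'), x ≫ b = a ≫ x' →
      ∃ c : Z ⟶ Z', y ≫ c = b ≫ y' ∧ E.push a δ = E.pull c δ'
  /-- (ET3)ᵒᵖ -/
  et3op : ∀ {A B Z A' B' Z' : C} (x : A ⟶ B) (y : B ⟶ Z) (x' : A' ⟶ B') (y' : B' ⟶ Z')
    (δ : E.grp Z A) (δ' : E.grp Z' A'), s δ = seqClass x y → s δ' = seqClass x' y' →
    ∀ (b : B ⟶ B') (c : Z ⟶ Z'), y ≫ c = b ≫ y' →
      ∃ a : A ⟶ A', x ≫ b = a ≫ x' ∧ E.push a δ = E.pull c δ'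
  /-- (ET4) -/
  et4 : ∀ {A B X D F : C} (f : A ⟶ B) (f' : B ⟶ D) (g : B ⟶ X) (g' : X ⟶ F)
    (δ : E.grp D A) (δ' : E.grp F B), s δ = seqClass f f' → s δ' = seqClass g g' →
    ∃ (Y : C) (h' : X ⟶ Y) (d : D ⟶ Y) (e : Y ⟶ F) (δ'' : E.grp Y A),
      s δ'' = seqClass (f ≫ g) h' ∧ f' ≫ d = g ≫ h' ∧ h' ≫ e = g' ∧
      s (E.push f' δ') = seqClass d e ∧
      E.pull d δ'' = δ ∧ E.push f δ'' = E.pull e δ'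
  /-- (ET4)ᵒᵖ -/
  et4op : ∀ {D A B F Z : C} (f' : D ⟶ A) (f : A ⟶ B) (g' : F ⟶ B) (g : B ⟶ Z)
    (δ : E.grp B D) (δ' : E.grp Z F), s δ = seqClass f' f → s δ' = seqClass g' g →
    ∃ (Y : C) (h' : Y ⟶ A) (d : D ⟶ Y) (e : Y ⟶ F) (δ'' : E.grp Z Y),
      s δ'' = seqClass h' (f ≫ g) ∧ d ≫ h' = f' ∧ h' ≫ f = e ≫ g' ∧
      s (E.pull g' δ) = seqClass d e ∧
      E.push e δ'' = δ' ∧ E.push d δ = E.pull g δ''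

section Basic

universe w v u

variable {C : Type u} [Category.{v} C] [Preadditive C] [HasZeroObject C] [HasBinaryBiproducts C]
  [Extriangulated.{w} C]

/-- `A ⟶ B ⟶ Z ⇢ δ` is an `E`-triangle. -/
def IsTriangle {A B Z : C} (x : A ⟶ B) (y : B ⟶ Z)
    (δ : (Extriangulated.E (C := C)).grp Z A) : Prop :=
  Extriangulated.s δ = seqClass x y

/-- `A ⟶ B ⟶ Z` is a conflation: it realizes some extension. -/
def IsConflation {A B Z : C} (x : A ⟶ B) (y : B ⟶ Z) : Prop :=
  ∃ δ : (Extriangulated.E (C := C)).grp Z A, IsTriangle x y δ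

/-- Inflations. -/
def IsInflation {A B : C} (x : A ⟶ B) : Prop :=
  ∃ (Z : C) (y : B ⟶ Z), IsConflation x y

/-- Deflations. -/
def IsDeflation {B Z : C} (y : B ⟶ Z) : Prop :=
  ∃ (A : C) (x : A ⟶ B), IsConflation x y

/-- Projective objects of an extriangulated category: those with the lifting property
along deflations. -/
def IsProj (P : C) : Prop :=
  ∀ {A B Z : C} (x : A ⟶ B) (y : B ⟶ Z), IsConflation x y →
    ∀ c : P ⟶ Z, ∃ b : P ⟶ B, b ≫ y = c

/-- A morphism is compatible if it is an isomorphism as soon as it is both an inflation and a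
deflation. -/
def IsCompatible {A B : C} (f : A ⟶ B) : Prop :=
  IsInflation f → IsDeflation f → IsIso f

/-- Left exact sequences `A ⟶ B ⟶ Z`. -/
def LeftExactSeq {A B Z : C} (f : A ⟶ B) (g : B ⟶ Z) : Prop :=
  ∃ (K : C) (g₁ : B ⟶ K) (g₂ : K ⟶ Z), IsConflation f g₁ ∧ IsInflation g₂ ∧
    IsCompatible g₂ ∧ g₁ ≫ g₂ = g

/-- Right exact sequences `A ⟶ B ⟶ Z`. -/
def RightExactSeq {A B Z : C} (f : A ⟶ B) (g : B ⟶ Z) : Prop :=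
  ∃ (K : C) (f₁ : A ⟶ K) (f₂ : K ⟶ B), IsConflation f₂ g ∧ IsDeflation f₁ ∧
    IsCompatible f₁ ∧ f₁ ≫ f₂ = f

/-- Left exact `E`-triangle sequences `A ⟶ B ⟶ Z ⟶ D`. -/
def LeftExactSeq₄ {A B Z D : C} (f : A ⟶ B) (g : B ⟶ Z) (h : Z ⟶ D) : Prop :=
  ∃ (K : C) (g₁ : B ⟶ K) (g₂ : K ⟶ Z), IsConflation f g₁ ∧ IsConflation g₂ h ∧
    IsCompatible g₂ ∧ g₁ ≫ g₂ = g

/-- Right exact `E`-triangle sequences `A ⟶ B ⟶ Z ⟶ D`. -/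
def RightExactSeq₄ {A B Z D : C} (f : A ⟶ B) (g : B ⟶ Z) (h : Z ⟶ D) : Prop :=
  ∃ (K : C) (g₁ : B ⟶ K) (g₂ : K ⟶ Z), IsConflation f g₁ ∧ IsConflation g₂ h ∧
    IsCompatible g₁ ∧ g₁ ≫ g₂ = g

variable (C) in
/-- Every object `Z` admits a conflation `A ⟶ P ⟶ Z` with `P` projective. -/
def HasEnoughProj : Prop :=
  ∀ Z : C, ∃ (A P : C) (x : A ⟶ P) (y : P ⟶ Z), IsConflation x y ∧ IsProj P

end Basic

/-- A negative first extension structure on an extriangulated category. -/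
class NegativeFirstExtensions.{z, w, v, u} (C : Type u) [Category.{v} C] [Preadditive C]
    [HasZeroObject C] [HasBinaryBiproducts C] [Extriangulated.{w} C] where
  /-- The additive bifunctor `E⁻¹`. -/
  En : AdditiveBifunctor.{z} C
  /-- The natural transformation `E⁻¹(-, Z) ⟶ C(-, A)` given by an extension `δ ∈ E(Z, A)`. -/
  lower : ∀ {Z A : C} (_ : (Extriangulated.E (C := C)).grp Z A) (W : C), En.grp W Z →+ (W ⟶ A)
  lower_natural : ∀ {Z A : C} (δ : (Extriangulated.E (C := C)).grp Z A) {W W' : C}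
    (f : W' ⟶ W) (ξ : En.grp W Z), lower δ W' (En.pull f ξ) = f ≫ lower δ W ξ
  /-- The natural transformation `E⁻¹(A, -) ⟶ C(Z, -)` given by an extension `δ ∈ E(Z, A)`. -/
  upper : ∀ {Z A : C} (_ : (Extriangulated.E (C := C)).grp Z A) (W : C), En.grp A W →+ (Z ⟶ W)
  upper_natural : ∀ {Z A : C} (δ : (Extriangulated.E (C := C)).grp Z A) {W W' : C}
    (f : W ⟶ W') (ξ : En.grp A W), upper δ W' (En.push f ξ) = upper δ W ξ ≫ f
  /-- Exactness of
  `E⁻¹(W, A) → E⁻¹(W, B) → E⁻¹(W, Z) → C(W, A) → C(W, B)` for each `E`-triangle. -/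
  exact_lower : ∀ {A B Z : C} (f : A ⟶ B) (g : B ⟶ Z)
    (δ : (Extriangulated.E (C := C)).grp Z A), IsTriangle f g δ → ∀ W : C,
    Function.Exact (En.push (X := W) f) (En.push (X := W) g) ∧
    Function.Exact (En.push (X := W) g) (lower δ W) ∧
    Function.Exact (lower δ W) (fun t : W ⟶ A => t ≫ f)
  /-- Exactness of
  `E⁻¹(Z, W) → E⁻¹(B, W) → E⁻¹(A, W) → C(Z, W) → C(B, W)` for each `E`-triangle. -/
  exact_upper : ∀ {A B Z : C} (f : A ⟶ B) (g : B ⟶ Z)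
    (δ : (Extriangulated.E (C := C)).grp Z A), IsTriangle f g δ → ∀ W : C,
    Function.Exact (En.pull (A := W) g) (En.pull (A := W) f) ∧
    Function.Exact (En.pull (A := W) f) (upper δ W) ∧
    Function.Exact (upper δ W) (fun t : Z ⟶ W => g ≫ t)

section Factorization

universe z w v u

variable {C : Type u} [Category.{v} C] [Preadditive C] [HasZeroObject C] [HasBinaryBiproducts C]
  [Extriangulated.{w} C] [NegativeFirstExtensions.{z} C]

variable (C) in
/-- The negative first extension structure is balanced: `E⁻¹(-, P) = 0` for `P` projective. -/
def IsBalanced : Prop :=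
  ∀ W P : C, IsProj P → ∀ ξ : (NegativeFirstExtensions.En (C := C)).grp W P, ξ = 0

/-- `C(cone l, cone r) = 0` and `E⁻¹(cone l, cone r) = 0`. (The cone of an inflation is unique
up to isomorphism, and all its representatives are used here.) -/
def Orthogonal {A B A' B' : C} (l : A ⟶ B) (r : A' ⟶ B') : Prop :=
  ∀ {Z Z' : C} (y : B ⟶ Z) (y' : B' ⟶ Z'), IsConflation l y → IsConflation r y' →
    (∀ t : Z ⟶ Z', t = 0) ∧
      ∀ ξ : (NegativeFirstExtensions.En (C := C)).grp Z Z', ξ = 0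

/-- The class `I^⊥` of inflations that are right orthogonal to all inflations in `I`. -/
def rightPerp (I : MorphismProperty C) : MorphismProperty C := fun _ _ f =>
  IsInflation f ∧ ∀ {A B : C} (g : A ⟶ B), IsInflation g → I g → Orthogonal g f

/-- The class `^⊥I` of inflations that are left orthogonal to all inflations in `I`. -/
def leftPerp (I : MorphismProperty C) : MorphismProperty C := fun _ _ f =>
  IsInflation f ∧ ∀ {A B : C} (g : A ⟶ B), IsInflation g → I g → Orthogonal f g

/-- Inflation factorization systems. -/
structure IsInflationFactorizationSystem (L R : MorphismProperty C) : Prop where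
  left_inflation : ∀ {A B : C} (f : A ⟶ B), L f → IsInflation f
  right_inflation : ∀ {A B : C} (f : A ⟶ B), R f → IsInflation f
  factorization : ∀ {A B : C} (f : A ⟶ B), IsInflation f →
    ∃ (K : C) (l : A ⟶ K) (r : K ⟶ B), L l ∧ R r ∧ l ≫ r = f
  left_eq : L = leftPerp R
  right_eq : rightPerp L = R

end Factorization

section Functors

universe w₁ v₁ u₁ w₂ v₂ u₂

variable {C : Type u₁} [Category.{v₁} C] [Preadditive C] [HasZeroObject C] [HasBinaryBiproducts C]
  [Extriangulated.{w₁} C]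
  {D : Type u₂} [Category.{v₂} D] [Preadditive D] [HasZeroObject D] [HasBinaryBiproducts D]
  [Extriangulated.{w₂} D]

/-- Exact functors between extriangulated categories: additive functors `F` for which there is
a natural transformation `η : E(-, -) ⟶ E(F -, F -)` such that `F` maps the realization of
each extension `δ` to the realization of `η δ`. -/
def IsExactFunctor (F : C ⥤ D) : Prop :=
  F.Additive ∧
  ∃ η : ∀ Z A : C, (Extriangulated.E (C := C)).grp Z A →+
      (Extriangulated.E (C := D)).grp (F.obj Z) (F.obj A),
    (∀ {Z A A' : C} (a : A ⟶ A') (δ : (Extriangulated.E (C := C)).grp Z A),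
      η Z A' (Extriangulated.E.push a δ) = Extriangulated.E.push (F.map a) (η Z A δ)) ∧
    (∀ {Z Z' A : C} (c : Z' ⟶ Z) (δ : (Extriangulated.E (C := C)).grp Z A),
      η Z' A (Extriangulated.E.pull c δ) = Extriangulated.E.pull (F.map c) (η Z A δ)) ∧
    ∀ {A B Z : C} (x : A ⟶ B) (y : B ⟶ Z) (δ : (Extriangulated.E (C := C)).grp Z A),
      IsTriangle x y δ → IsTriangle (F.map x) (F.map y) (η Z A δ)

/-- Left exact functors between extriangulated categories. -/
structure IsLeftExactFunctor (F : C ⥤ D) : Prop where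
  additive : F.Additive
  map_compatible : ∀ {A B : C} (f : A ⟶ B), IsCompatible f → IsCompatible (F.map f)
  map_leftExact : ∀ {A B Z : C} (f : A ⟶ B) (g : B ⟶ Z),
    LeftExactSeq f g → LeftExactSeq (F.map f) (F.map g)

/-- Right exact functors between extriangulated categories. -/
structure IsRightExactFunctor (F : C ⥤ D) : Prop where
  additive : F.Additive
  map_compatible : ∀ {A B : C} (f : A ⟶ B), IsCompatible f → IsCompatible (F.map f)
  map_rightExact : ∀ {A B Z : C} (f : A ⟶ B) (g : B ⟶ Z),
    RightExactSeq f g → RightExactSeq (F.map f) (F.map g)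

/-- The functor maps projective objects to projective objects. -/
def PreservesProj (F : C ⥤ D) : Prop :=
  ∀ P : C, IsProj P → IsProj (F.obj P)

end Functors

universe w₁ v₁ u₁ w₂ v₂ u₂ w₃ v₃ u₃

/-- A recollement of the extriangulated category `B` relative to `A` and `C`. The functors
`iUp`, `iLow`, `iShriek` are `i^*`, `i_*`, `i^!`, and `jShriek`, `jUp`, `jLow` are
`j_!`, `j^*`, `j_*`. -/
structure Recollement
    (A : Type u₁) [Category.{v₁} A] [Preadditive A] [HasZeroObject A] [HasBinaryBiproducts A]
    [Extriangulated.{w₁} A]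
    (B : Type u₂) [Category.{v₂} B] [Preadditive B] [HasZeroObject B] [HasBinaryBiproducts B]
    [Extriangulated.{w₂} B]
    (C : Type u₃) [Category.{v₃} C] [Preadditive C] [HasZeroObject C] [HasBinaryBiproducts C]
    [Extriangulated.{w₃} C] where
  iUp : B ⥤ A
  iLow : A ⥤ B
  iShriek : B ⥤ A
  jShriek : C ⥤ B
  jUp : B ⥤ C
  jLow : C ⥤ B
  iLow_exact : IsExactFunctor iLow
  jUp_exact : IsExactFunctor jUp
  iUp_rightExact : IsRightExactFunctor iUp
  jShriek_rightExact : IsRightExactFunctor jShriek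
  iShriek_leftExact : IsLeftExactFunctor iShriek
  jLow_leftExact : IsLeftExactFunctor jLow
  /-- The adjoint triples `(i^*, i_*, i^!)` and `(j_!, j^*, j_*)`. -/
  adjUpLow : iUp ⊣ iLow
  adjLowShriek : iLow ⊣ iShriek
  adjShriekUp : jShriek ⊣ jUp
  adjUpLow' : jUp ⊣ jLow
  /-- The essential image of `i_*` is the kernel of `j^*`. -/
  image_eq_kernel : ∀ X : B, iLow.essImage X ↔ IsZero (jUp.obj X)
  /-- `i_*`, `j_!` and `j_*` are fully faithful. -/
  iLow_full : iLow.Full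
  iLow_faithful : iLow.Faithful
  jShriek_full : jShriek.Full
  jShriek_faithful : jShriek.Faithful
  jLow_full : jLow.Full
  jLow_faithful : jLow.Faithful
  /-- `i_* i^! X ⟶ X ⟶ j_* j^* X ⟶ i_* Y` is left exact for some `Y`. -/
  left_seq : ∀ X : B, ∃ (Y : A) (h : jLow.obj (jUp.obj X) ⟶ iLow.obj Y),
    LeftExactSeq₄ (adjLowShriek.counit.app X) (adjUpLow'.unit.app X) h
  /-- `i_* Y ⟶ j_! j^* X ⟶ X ⟶ i_* i^* X` is right exact for some `Y`. -/
  right_seq : ∀ X : B, ∃ (Y : A) (h : iLow.obj Y ⟶ jShriek.obj (jUp.obj X)),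
    RightExactSeq₄ h (adjShriekUp.counit.app X) (adjUpLow.unit.app X)

section Gluing

variable {A : Type u₁} [Category.{v₁} A] [Preadditive A] [HasZeroObject A] [HasBinaryBiproducts A]
  [Extriangulated.{w₁} A]
  {B : Type u₂} [Category.{v₂} B] [Preadditive B] [HasZeroObject B] [HasBinaryBiproducts B]
  [Extriangulated.{w₂} B]
  {C : Type u₃} [Category.{v₃} C] [Preadditive C] [HasZeroObject C] [HasBinaryBiproducts C]
  [Extriangulated.{w₃} C]

/-- The class of inflations `f` of `B` with `i^* f` in `E₁` and `j^* f` in `E₂`. -/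
def Recollement.glueLeft (r : Recollement A B C) (E₁ : MorphismProperty A)
    (E₂ : MorphismProperty C) : MorphismProperty B := fun _ _ f =>
  IsInflation f ∧ E₁ (r.iUp.map f) ∧ E₂ (r.jUp.map f)

/-- The class of inflations `g` of `B` with `i^! g` in `M₁` and `j^* g` in `M₂`. -/
def Recollement.glueRight (r : Recollement A B C) (M₁ : MorphismProperty A)
    (M₂ : MorphismProperty C) : MorphismProperty B := fun _ _ g =>
  IsInflation g ∧ M₁ (r.iShriek.map g) ∧ M₂ (r.jUp.map g)

end Gluing

end Extri

open Extri

/-!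
The conditions defining an inflation factorization system only see the cones of inflations, so
such a system is the same thing as an `s`-torsion pair: orthogonal classes `T`, `F` of objects
(no morphisms and no `E⁻¹` from `T` to `F`) such that each object `X` lies in a conflation
`U ⟶ X ⟶ V` with `U` in `T` and `V` in `F`
(`IsInflationFactorizationSystem.isTorsionPair` and `IsTorsionPair.isInflationFactorizationSystem`).
As `i^*`, `i^!` and `j^*` are exact and therefore preserve cones, it remains to glue torsion pairs:
`T` consists of the `X` with `i^* X` in `T₁` and `j^* X` in `T₂`, and `F` of the `X` with `i^! X` in
`F₁` and `j^* X` in `F₂`.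

Exactness of `i^!` and `i^*` turns the four-term sequences of the recollement into conflations
`i_* i^! X ⟶ X ⟶ j_* j^* X` and `j_! j^* X ⟶ X ⟶ i_* i^* X`.

*Orthogonality* (`Recollement.objOrthogonal`). Let `X` be in `T` and `Y` in `F`. A morphism
`X ⟶ Y` is killed by `j^*`, hence is induced by a morphism `i^* X ⟶ i^! Y`, which is zero. For
`E⁻¹(X, Y)`, choose a conflation `K ⟶ P ⟶ Y` with `P` projective. Since `E⁻¹(-, P) = 0`, the group
`E⁻¹(X, Y)` is the kernel of `B(X, K) ⟶ B(X, P)`. An element `t` of this kernel has `j^* t = 0`,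
as `j^* t` comes from `E⁻¹(j^* X, j^* Y) = 0`; so `t` is induced by some `s : i^* X ⟶ i^! K`. The
composite of `s` with `i^! K ⟶ i^! P` vanishes because `E⁻¹(j_! j^* X, P) = 0`
(`Recollement.eq_zero_of_isProj`), and thus `s` comes from `E⁻¹(i^* X, i^! Y) = 0`.

*Decomposition* (`Recollement.exists_isConflation`). This is the construction of Beilinson,
Bernstein and Deligne, with (ET4) and (ET4)ᵒᵖ in place of the octahedral axiom. The functor `j_*` is
only left exact, but the cone `K` of the image under `j_*` of a torsion part `U₂ ⟶ j^* X` is as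
good as the image of the torsion-free part: `i^! K = 0`, and `j^* K` is a cone of `U₂ ⟶ j^* X`.
-/

open scoped ZeroObject

namespace Extri

/-! ### Biadditive functors -/

namespace AdditiveBifunctor

universe w v u

variable {C : Type u} [Category.{v} C] [Preadditive C] (E : AdditiveBifunctor.{w} C)

lemma push_comp {X A A' A'' : C} (a : A ⟶ A') (b : A' ⟶ A'') (δ : E.grp X A) :
    E.push (a ≫ b) δ = E.push b (E.push a δ) := by
  simp [push]

lemma push_id {X A : C} (δ : E.grp X A) : E.push (𝟙 A) δ = δ := by
  simp [push]

lemma pull_comp {X X' X'' A : C} (c : X' ⟶ X) (d : X'' ⟶ X') (δ : E.grp X A) :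
    E.pull (d ≫ c) δ = E.pull d (E.pull c δ) := by
  simp [pull]

lemma pull_id {X A : C} (δ : E.grp X A) : E.pull (𝟙 X) δ = δ := by
  simp [pull]

lemma push_pull {X X' A A' : C} (a : A ⟶ A') (c : X' ⟶ X) (δ : E.grp X A) :
    E.push a (E.pull c δ) = E.pull c (E.push a δ) := by
  have := ConcreteCategory.congr_hom ((E.toFunctor.map c.op).naturality a) δ
  exact this.symm

lemma push_zero {X A A' : C} (δ : E.grp X A) : E.push (0 : A ⟶ A') δ = 0 := by
  have := E.additive_right (op X)
  simp [push]

lemma pull_zero {X X' A : C} (δ : E.grp X A) : E.pull (0 : X' ⟶ X) δ = 0 := by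
  have := E.additive_left
  simp [pull]

lemma pull_sub {X X' A : C} (c d : X' ⟶ X) (δ : E.grp X A) :
    E.pull (c - d) δ = E.pull c δ - E.pull d δ := by
  have := E.additive_left
  simp [pull, Functor.map_sub]

lemma eq_zero_of_isZero_right {X A : C} (h : IsZero A) (δ : E.grp X A) : δ = 0 := by
  rw [← E.push_id δ, h.eq_of_src (𝟙 A) 0, E.push_zero]

lemma eq_zero_of_isZero_left {X A : C} (h : IsZero X) (δ : E.grp X A) : δ = 0 := by
  rw [← E.pull_id δ, h.eq_of_src (𝟙 X) 0, E.pull_zero]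

end AdditiveBifunctor

/-! ### Conflations -/

section Preliminaries

universe v u

variable {C : Type u} [Category.{v} C]

/-- The inverse of `e = 1 + n` with `n² = 0` is `1 - n = 2 - e`. -/
lemma isIso_of_sub_id_sq_eq_zero [Preadditive C] {X : C} (e : X ⟶ X)
    (h : (e - 𝟙 X) ≫ (e - 𝟙 X) = 0) : IsIso e := by
  have h' : e ≫ e = e + e - 𝟙 X := by
    simp only [Preadditive.comp_sub, Preadditive.sub_comp, Category.comp_id,
      Category.id_comp] at h
    rw [← sub_eq_zero, ← h]
    abel
  refine ⟨𝟙 X + 𝟙 X - e, ?_, ?_⟩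
  · simp [Preadditive.comp_sub, Preadditive.comp_add, h']
  · simp [Preadditive.sub_comp, Preadditive.add_comp, h']

lemma isIso_of_isIso_comp_of_isIso_comp {X Y : C} (c : X ⟶ Y) (c' : Y ⟶ X)
    (h : IsIso (c ≫ c')) (h' : IsIso (c' ≫ c)) : IsIso c := by
  have : IsSplitMono c := ⟨⟨c' ≫ inv (c ≫ c'), by rw [← Category.assoc, IsIso.hom_inv_id]⟩⟩
  have : IsSplitEpi c := ⟨⟨inv (c' ≫ c) ≫ c', by rw [Category.assoc, IsIso.inv_hom_id]⟩⟩
  exact isIso_of_epi_of_isSplitMono c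

lemma seqClass_eq_iff {A Z B B' : C} (x : A ⟶ B) (y : B ⟶ Z) (x' : A ⟶ B') (y' : B' ⟶ Z) :
    seqClass x y = seqClass x' y' ↔
      ∃ b : B ≅ B', x ≫ b.hom = x' ∧ b.hom ≫ y' = y :=
  ⟨fun h => Quotient.exact h, fun h => Quotient.sound h⟩

end Preliminaries

section Conflations

universe w v u

variable {C : Type u} [Category.{v} C] [Preadditive C] [HasZeroObject C] [HasBinaryBiproducts C]
  [Extriangulated.{w} C]

lemma exists_isTriangle {Z A : C} (δ : (Extriangulated.E (C := C)).grp Z A) :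
    ∃ (B : C) (x : A ⟶ B) (y : B ⟶ Z), IsTriangle x y δ := by
  obtain ⟨⟨B, x, y⟩, h⟩ := Quotient.exists_rep (Extriangulated.s δ)
  exact ⟨B, x, y, h.symm⟩

lemma isTriangle_id_left (A : C) {O : C} (hO : IsZero O) :
    IsTriangle (𝟙 A) (0 : A ⟶ O) (0 : (Extriangulated.E (C := C)).grp O A) := by
  rw [IsTriangle, Extriangulated.s_zero, seqClass_eq_iff]
  refine ⟨⟨biprod.fst, biprod.inl, ?_, by simp⟩, by simp, hO.eq_of_tgt _ _⟩
  apply biprod.hom_ext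
  · simp
  · exact hO.eq_of_tgt _ _

lemma isTriangle_id_right (Z : C) {O : C} (hO : IsZero O) :
    IsTriangle (0 : O ⟶ Z) (𝟙 Z) (0 : (Extriangulated.E (C := C)).grp Z O) := by
  rw [IsTriangle, Extriangulated.s_zero, seqClass_eq_iff]
  refine ⟨⟨biprod.snd, biprod.inr, ?_, by simp⟩, hO.eq_of_src _ _, by simp⟩
  apply biprod.hom_ext
  · exact hO.eq_of_tgt _ _
  · simp

namespace IsConflation

variable {A B Z : C} {f : A ⟶ B} {g : B ⟶ Z}

lemma comp_eq_zero (h : IsConflation f g) : f ≫ g = 0 := by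
  obtain ⟨δ, h⟩ := h
  obtain ⟨c, hc, -⟩ := Extriangulated.et3 _ _ _ _ _ _
    (isTriangle_id_left A (isZero_zero C)) h (𝟙 A) f (by simp)
  simp [← hc]

lemma exists_lift (h : IsConflation f g) {W : C} (w : W ⟶ B) (hw : w ≫ g = 0) :
    ∃ a : W ⟶ A, a ≫ f = w := by
  obtain ⟨δ, h⟩ := h
  obtain ⟨a, ha, -⟩ := Extriangulated.et3op _ _ _ _ _ _
    (isTriangle_id_left W (isZero_zero C)) h w 0 (by simp [hw])
  exact ⟨a, by simp [← ha]⟩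

lemma isIso_of_isZero_left (h : IsConflation f g) (hA : IsZero A) : IsIso g := by
  obtain ⟨δ, h⟩ := h
  obtain rfl := Extriangulated.E.eq_zero_of_isZero_right hA δ
  obtain ⟨b, -, hb⟩ := (seqClass_eq_iff _ _ _ _).1 (h.symm.trans (isTriangle_id_right Z hA))
  rw [← hb]
  infer_instance

lemma isIso_of_isZero_right (h : IsConflation f g) (hZ : IsZero Z) : IsIso f := by
  obtain ⟨δ, h⟩ := h
  obtain rfl := Extriangulated.E.eq_zero_of_isZero_left hZ δ
  obtain ⟨b, hb, -⟩ := (seqClass_eq_iff _ _ _ _).1 ((isTriangle_id_left A hZ).symm.trans h)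
  rw [← hb]
  infer_instance

lemma isZero_right (h : IsConflation f g) (hA : IsZero A) (hB : IsZero B) : IsZero Z :=
  have := h.isIso_of_isZero_left hA
  hB.of_iso (asIso g).symm

lemma isZero_left (h : IsConflation f g) (hB : IsZero B) (hZ : IsZero Z) : IsZero A :=
  have := h.isIso_of_isZero_right hZ
  hB.of_iso (asIso f)

end IsConflation

/-- A morphism lifts along a deflation as soon as it pulls the extension back to zero. -/
lemma IsTriangle.exists_lift_of_pull_eq_zero {A B Z : C} {f : A ⟶ B} {g : B ⟶ Z}
    {δ : (Extriangulated.E (C := C)).grp Z A} (h : IsTriangle f g δ) {W : C} (w : W ⟶ Z)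
    (hw : Extriangulated.E.pull w δ = 0) : ∃ u : W ⟶ B, u ≫ g = w := by
  obtain ⟨b, -, hb⟩ := Extriangulated.realization _ _ _ _ _ _ (Extriangulated.s_zero W A) h
    (𝟙 A) w (by rw [map_zero, hw])
  exact ⟨biprod.inr ≫ b, by simp [← hb]⟩

/-- A self-map of an `E`-triangle that is the identity on `A` and `B` is an isomorphism on `Z`:
the endomorphism `e` is unipotent, since `e - 1` is killed by precomposition with `g` and factors
through `g`. -/
lemma IsTriangle.isIso_right {A B Z : C} {f : A ⟶ B} {g : B ⟶ Z}
    {δ : (Extriangulated.E (C := C)).grp Z A} (h : IsTriangle f g δ) (e : Z ⟶ Z)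
    (he : g ≫ e = g) (hδ : Extriangulated.E.pull e δ = δ) : IsIso e := by
  obtain ⟨u, hu⟩ := h.exists_lift_of_pull_eq_zero (e - 𝟙 Z)
    (by rw [AdditiveBifunctor.pull_sub, AdditiveBifunctor.pull_id, hδ, sub_self])
  apply isIso_of_sub_id_sq_eq_zero
  nth_rw 1 [← hu]
  simp [he]

/-- A self-map of a conflation that is the identity on both end terms is an isomorphism: the
endomorphism `e` is unipotent, since `e - 1` factors through `f` and vanishes on `f`. -/
lemma IsConflation.isIso_middle {A B Z : C} {f : A ⟶ B} {g : B ⟶ Z}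
    (h : IsConflation f g) (e : B ⟶ B) (he : f ≫ e = f) (he' : e ≫ g = g) : IsIso e := by
  obtain ⟨u, hu⟩ := h.exists_lift (e - 𝟙 B) (by simp [he'])
  apply isIso_of_sub_id_sq_eq_zero
  nth_rw 1 [← hu]
  simp [he]

/-- The cone of an inflation is unique up to isomorphism. -/
lemma IsConflation.nonempty_cone_iso {A B Z Z' : C} {f : A ⟶ B} {g : B ⟶ Z} {g' : B ⟶ Z'}
    (h : IsConflation f g) (h' : IsConflation f g') : Nonempty (Z ≅ Z') := by
  obtain ⟨δ, h⟩ := h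
  obtain ⟨δ', h'⟩ := h'
  obtain ⟨c, hc, hδ⟩ := Extriangulated.et3 _ _ _ _ _ _ h h' (𝟙 A) (𝟙 B) (by simp)
  obtain ⟨c', hc', hδ'⟩ := Extriangulated.et3 _ _ _ _ _ _ h' h (𝟙 A) (𝟙 B) (by simp)
  rw [AdditiveBifunctor.push_id] at hδ hδ'
  rw [Category.id_comp] at hc hc'
  have := isIso_of_isIso_comp_of_isIso_comp c c'
    (h.isIso_right _ (by rw [← Category.assoc, hc, hc'])
      (by rw [AdditiveBifunctor.pull_comp, ← hδ', ← hδ]))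
    (h'.isIso_right _ (by rw [← Category.assoc, hc', hc])
      (by rw [AdditiveBifunctor.pull_comp, ← hδ, ← hδ']))
  exact ⟨asIso c⟩

lemma IsConflation.comp_middle_iso {A B B' Z : C} {f : A ⟶ B} {g : B ⟶ Z}
    (h : IsConflation f g) (b : B ≅ B') : IsConflation (f ≫ b.hom) (b.inv ≫ g) := by
  obtain ⟨δ, h⟩ := h
  exact ⟨δ, h.trans ((seqClass_eq_iff _ _ _ _).2 ⟨b, rfl, by simp⟩)⟩

/-- Conflations are stable under isomorphisms of the end terms. -/
lemma IsConflation.iso_comp {A B Z A' Z' : C} {f : A ⟶ B} {g : B ⟶ Z}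
    (h : IsConflation f g) (a : A' ≅ A) (c : Z ≅ Z') :
    IsConflation (a.hom ≫ f) (g ≫ c.hom) := by
  obtain ⟨δ, h⟩ := h
  -- Realize the transported extension; five-lemma arguments identify its middle term with `B`.
  set δ' := Extriangulated.E.push a.inv (Extriangulated.E.pull c.inv δ) with hδ'
  obtain ⟨B', x, y, h'⟩ := exists_isTriangle δ'
  obtain ⟨b, hb₁, hb₂⟩ := Extriangulated.realization _ _ _ _ _ _ h h' a.inv c.hom (by
    rw [hδ', ← AdditiveBifunctor.push_pull, ← AdditiveBifunctor.pull_comp]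
    simp [AdditiveBifunctor.pull_id])
  obtain ⟨b', hb₁', hb₂'⟩ := Extriangulated.realization _ _ _ _ _ _ h' h a.hom c.inv (by
    rw [hδ', ← AdditiveBifunctor.push_comp]
    simp [AdditiveBifunctor.push_id])
  have := isIso_of_isIso_comp_of_isIso_comp b b'
    (IsConflation.isIso_middle ⟨δ, h⟩ _ (by rw [← Category.assoc, hb₁, Category.assoc, hb₁']; simp)
      (by rw [Category.assoc, ← hb₂', ← Category.assoc, ← hb₂]; simp))
    (IsConflation.isIso_middle ⟨δ', h'⟩ _
      (by rw [← Category.assoc, hb₁', Category.assoc, hb₁]; simp)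
      (by rw [Category.assoc, ← hb₂, ← Category.assoc, ← hb₂']; simp))
  have h'' := IsConflation.comp_middle_iso ⟨δ', h'⟩ (asIso b).symm
  simpa [(IsIso.comp_inv_eq b).2 (show x = (a.hom ≫ f) ≫ b by simp [hb₁]), ← hb₂] using h''

end Conflations

/-! ### Torsion pairs and inflation factorization systems -/

section TorsionPairs

universe z w v u

variable {C : Type u} [Category.{v} C] [Preadditive C] [HasZeroObject C] [HasBinaryBiproducts C]
  [Extriangulated.{w} C] [NegativeFirstExtensions.{z} C]

/-- The negative extensions enter here: the identity of the cone comes from an element of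
`E⁻¹(A, Z)` that extends to `E⁻¹(B, Z)`. -/
lemma IsConflation.isZero_of_isIso_left {A B Z : C} {f : A ⟶ B} {g : B ⟶ Z}
    (h : IsConflation f g) [IsIso f] : IsZero Z := by
  have hg : g = 0 := by rw [← cancel_epi f, h.comp_eq_zero, comp_zero]
  obtain ⟨δ, h⟩ := h
  obtain ⟨-, h₁, h₂⟩ := NegativeFirstExtensions.exact_upper _ _ _ h Z
  obtain ⟨ξ, hξ⟩ := (h₂ (𝟙 Z)).1 (by simp [hg])
  rw [IsZero.iff_id_eq_zero, ← hξ]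
  refine (h₁ ξ).2 ⟨NegativeFirstExtensions.En.pull (inv f) ξ, ?_⟩
  rw [← AdditiveBifunctor.pull_comp, IsIso.hom_inv_id, AdditiveBifunctor.pull_id]

lemma IsConflation.isZero_of_isIso_right {A B Z : C} {f : A ⟶ B} {g : B ⟶ Z}
    (h : IsConflation f g) [IsIso g] : IsZero A := by
  have hf : f = 0 := by rw [← cancel_mono g, h.comp_eq_zero, zero_comp]
  obtain ⟨δ, h⟩ := h
  obtain ⟨-, h₁, h₂⟩ := NegativeFirstExtensions.exact_lower _ _ _ h A
  obtain ⟨ξ, hξ⟩ := (h₂ (𝟙 A)).1 (by simp [hf])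
  rw [IsZero.iff_id_eq_zero, ← hξ]
  refine (h₁ ξ).2 ⟨NegativeFirstExtensions.En.push (inv g) ξ, ?_⟩
  rw [← AdditiveBifunctor.push_comp, IsIso.inv_hom_id, AdditiveBifunctor.push_id]

/-- Orthogonality of objects: `C(X, Y) = 0` and `E⁻¹(X, Y) = 0`. -/
def ObjOrthogonal (X Y : C) : Prop :=
  (∀ t : X ⟶ Y, t = 0) ∧ ∀ ξ : (NegativeFirstExtensions.En (C := C)).grp X Y, ξ = 0

lemma ObjOrthogonal.of_iso {X Y X' Y' : C} (h : ObjOrthogonal X Y) (e : X ≅ X') (e' : Y ≅ Y') :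
    ObjOrthogonal X' Y' := by
  constructor
  · intro t
    rw [← cancel_epi e.hom, ← cancel_mono e'.inv, h.1 ((e.hom ≫ t) ≫ e'.inv)]
    simp
  · intro ξ
    have h₀ := h.2 (NegativeFirstExtensions.En.push e'.inv
      (NegativeFirstExtensions.En.pull e.hom ξ))
    have h₁ := congrArg (fun ζ => NegativeFirstExtensions.En.pull e.inv
      (NegativeFirstExtensions.En.push e'.hom ζ)) h₀
    simpa only [← AdditiveBifunctor.push_comp, ← AdditiveBifunctor.pull_comp, e.inv_hom_id,
      e'.inv_hom_id, AdditiveBifunctor.push_id, AdditiveBifunctor.pull_id, map_zero] using h₁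

/-- Orthogonality of inflations can be tested on a single choice of cones. -/
lemma orthogonal_iff {A B Z A' B' Z' : C} {l : A ⟶ B} {y : B ⟶ Z} {r : A' ⟶ B'} {y' : B' ⟶ Z'}
    (h : IsConflation l y) (h' : IsConflation r y') : Orthogonal l r ↔ ObjOrthogonal Z Z' := by
  refine ⟨fun H => H y y' h h', fun H W W' x x' hx hx' => ?_⟩
  obtain ⟨e⟩ := h.nonempty_cone_iso hx
  obtain ⟨e'⟩ := h'.nonempty_cone_iso hx'
  exact H.of_iso e e'

/-- An `s`-torsion pair: orthogonal classes of objects such that every object `X` lies in a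
conflation `U ⟶ X ⟶ V` with `U` in the torsion class `T` and `V` in the torsion-free class
`F`. -/
structure IsTorsionPair (T F : ObjectProperty C) : Prop where
  left_iso : T.IsClosedUnderIsomorphisms
  right_iso : F.IsClosedUnderIsomorphisms
  orthogonal : ∀ {X Y : C}, T X → F Y → ObjOrthogonal X Y
  exists_conflation : ∀ X : C, ∃ (U V : C) (x : U ⟶ X) (y : X ⟶ V), IsConflation x y ∧ T U ∧ F V

/-- The objects isomorphic to the cone of a morphism in `I`. -/
def coneClass (I : MorphismProperty C) : ObjectProperty C := fun X =>
  ∃ (A B Z : C) (f : A ⟶ B) (y : B ⟶ Z), I f ∧ IsConflation f y ∧ Nonempty (Z ≅ X)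

instance (I : MorphismProperty C) : (coneClass I).IsClosedUnderIsomorphisms where
  of_iso := by
    rintro X X' e ⟨A, B, Z, f, y, hf, hy, ⟨e'⟩⟩
    exact ⟨A, B, Z, f, y, hf, hy, ⟨e' ≪≫ e⟩⟩

namespace IsInflationFactorizationSystem

variable {L R : MorphismProperty C}

/-- Membership in the left class depends only on the cone. -/
lemma left_iff (h : IsInflationFactorizationSystem L R) {A B Z : C} {f : A ⟶ B} {y : B ⟶ Z}
    (hf : IsConflation f y) : L f ↔ coneClass L Z := by
  refine ⟨fun H => ⟨_, _, _, f, y, H, hf, ⟨Iso.refl _⟩⟩, ?_⟩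
  rintro ⟨A', B', Z', l, y', hl, hy', ⟨e⟩⟩
  have hl' : leftPerp R l := h.left_eq ▸ hl
  rw [h.left_eq]
  refine ⟨⟨_, _, hf⟩, fun r hr hR => ?_⟩
  obtain ⟨W, x, hx⟩ := hr
  exact (orthogonal_iff hf hx).2
    (((orthogonal_iff hy' hx).1 (hl'.2 r ⟨_, _, hx⟩ hR)).of_iso e (Iso.refl _))

/-- Membership in the right class depends only on the cone. -/
lemma right_iff (h : IsInflationFactorizationSystem L R) {A B Z : C} {f : A ⟶ B} {y : B ⟶ Z}
    (hf : IsConflation f y) : R f ↔ coneClass R Z := by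
  refine ⟨fun H => ⟨_, _, _, f, y, H, hf, ⟨Iso.refl _⟩⟩, ?_⟩
  rintro ⟨A', B', Z', r, y', hr, hy', ⟨e⟩⟩
  have hr' : rightPerp L r := h.right_eq.symm ▸ hr
  rw [← h.right_eq]
  refine ⟨⟨_, _, hf⟩, fun l hl hL => ?_⟩
  obtain ⟨W, x, hx⟩ := hl
  exact (orthogonal_iff hx hf).2
    (((orthogonal_iff hx hy').1 (hr'.2 l ⟨_, _, hx⟩ hL)).of_iso (Iso.refl _) e)

/-- The cones of the two classes of an inflation factorization system form a torsion pair: the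
torsion decomposition of `X` comes from the factorization of `0 ⟶ X`. -/
lemma isTorsionPair (h : IsInflationFactorizationSystem L R) :
    IsTorsionPair (coneClass L) (coneClass R) where
  left_iso := inferInstance
  right_iso := inferInstance
  orthogonal := by
    rintro X Y ⟨A, B, Z, l, y, hl, hy, ⟨e⟩⟩ ⟨A', B', Z', r, y', hr, hy', ⟨e'⟩⟩
    have hl' : leftPerp R l := h.left_eq ▸ hl
    exact ((orthogonal_iff hy hy').1 (hl'.2 r ⟨_, _, hy'⟩ hr)).of_iso e e'
  exists_conflation X := by
    obtain ⟨K, l, r, hl, hr, -⟩ := h.factorization (0 : (0 : C) ⟶ X)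
      ⟨_, _, 0, isTriangle_id_right X (isZero_zero C)⟩
    obtain ⟨V, y, hy⟩ := h.right_inflation r hr
    obtain rfl : l = 0 := (isZero_zero C).eq_of_src _ _
    exact ⟨K, V, r, y, hy, (h.left_iff ⟨0, isTriangle_id_right K (isZero_zero C)⟩).1 hl,
      (h.right_iff hy).1 hr⟩

end IsInflationFactorizationSystem

namespace IsTorsionPair

variable {T F : ObjectProperty C}

/-- The torsion-free part of an object left orthogonal to `F` is zero: its identity comes from
`E⁻¹(U, V) = 0`. -/
lemma left_of_orthogonal (h : IsTorsionPair T F) {X : C}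
    (hX : ∀ Y, F Y → ObjOrthogonal X Y) : T X := by
  obtain ⟨U, V, x, y, hxy, hU, hV⟩ := h.exists_conflation X
  have hV' : IsZero V := by
    obtain ⟨δ, hδ⟩ := hxy
    obtain ⟨ξ, hξ⟩ := ((NegativeFirstExtensions.exact_upper _ _ _ hδ V).2.2 (𝟙 V)).1
      (by simpa using (hX V hV).1 y)
    rw [IsZero.iff_id_eq_zero, ← hξ, (h.orthogonal hU hV).2 ξ, map_zero]
  have := hxy.isIso_of_isZero_right hV'
  have := h.left_iso
  exact T.prop_of_iso (asIso x) hU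

lemma right_of_orthogonal (h : IsTorsionPair T F) {X : C}
    (hX : ∀ Y, T Y → ObjOrthogonal Y X) : F X := by
  obtain ⟨U, V, x, y, hxy, hU, hV⟩ := h.exists_conflation X
  have hU' : IsZero U := by
    obtain ⟨δ, hδ⟩ := hxy
    obtain ⟨ξ, hξ⟩ := ((NegativeFirstExtensions.exact_lower _ _ _ hδ U).2.2 (𝟙 U)).1
      (by simpa using (hX U hU).1 x)
    rw [IsZero.iff_id_eq_zero, ← hξ, (h.orthogonal hU hV).2 ξ, map_zero]
  have := hxy.isIso_of_isZero_left hU'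
  have := h.right_iso
  exact F.prop_of_iso (asIso y).symm hV

/-- The inflations with cone in `T` and those with cone in `F` form an inflation factorization
system: an inflation `f` is factored by pulling the torsion decomposition of its cone back along
the deflation onto the cone, with (ET4)ᵒᵖ. -/
lemma isInflationFactorizationSystem (h : IsTorsionPair T F) {L R : MorphismProperty C}
    (hL : ∀ {A B Z : C} {f : A ⟶ B} {y : B ⟶ Z}, IsConflation f y → (L f ↔ T Z))
    (hR : ∀ {A B Z : C} {f : A ⟶ B} {y : B ⟶ Z}, IsConflation f y → (R f ↔ F Z))
    (hL' : ∀ {A B : C} (f : A ⟶ B), L f → IsInflation f)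
    (hR' : ∀ {A B : C} (f : A ⟶ B), R f → IsInflation f) :
    IsInflationFactorizationSystem L R where
  left_inflation := hL'
  right_inflation := hR'
  factorization := by
    rintro A B f ⟨Z, y, δ, hδ⟩
    obtain ⟨U, V, u, v, ⟨δ', hδ'⟩, hU, hV⟩ := h.exists_conflation Z
    obtain ⟨Y, p, d, e, δ'', h₁, h₂, -, h₃, -⟩ := Extriangulated.et4op _ _ _ _ _ _ hδ hδ'
    exact ⟨Y, d, p, (hL ⟨_, h₃⟩).2 hU, (hR ⟨_, h₁⟩).2 hV, h₂⟩
  left_eq := by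
    ext A B f
    constructor
    · intro hf
      obtain ⟨Z, y, hy⟩ := hL' f hf
      refine ⟨⟨Z, y, hy⟩, ?_⟩
      rintro A' B' r ⟨Z', y', hy'⟩ hr
      exact (orthogonal_iff hy hy').2 (h.orthogonal ((hL hy).1 hf) ((hR hy').1 hr))
    · rintro ⟨⟨Z, y, hy⟩, hf⟩
      refine (hL hy).2 (h.left_of_orthogonal fun Y hY => ?_)
      have hY' : IsConflation (0 : (0 : C) ⟶ Y) (𝟙 Y) := ⟨0, isTriangle_id_right Y (isZero_zero C)⟩
      exact (orthogonal_iff hy hY').1 (hf _ ⟨_, _, hY'⟩ ((hR hY').2 hY))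
  right_eq := by
    ext A B f
    constructor
    · rintro ⟨⟨Z, y, hy⟩, hf⟩
      refine (hR hy).2 (h.right_of_orthogonal fun Y hY => ?_)
      have hY' : IsConflation (0 : (0 : C) ⟶ Y) (𝟙 Y) := ⟨0, isTriangle_id_right Y (isZero_zero C)⟩
      exact (orthogonal_iff hY' hy).1 (hf _ ⟨_, _, hY'⟩ ((hL hY').2 hY))
    · intro hf
      obtain ⟨Z, y, hy⟩ := hR' f hf
      refine ⟨⟨Z, y, hy⟩, ?_⟩
      rintro A' B' l ⟨Z', y', hy'⟩ hl
      exact (orthogonal_iff hy' hy).2 (h.orthogonal ((hL hy').1 hl) ((hR hy).1 hf))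

end IsTorsionPair

end TorsionPairs

/-! ### Recollements with exact `i^*` and `i^!` -/

section Recollements

universe w₁ v₁ u₁ w₂ v₂ u₂ w₃ v₃ u₃

lemma IsExactFunctor.map_isConflation
    {C : Type u₁} [Category.{v₁} C] [Preadditive C] [HasZeroObject C] [HasBinaryBiproducts C]
    [Extriangulated.{w₁} C]
    {D : Type u₂} [Category.{v₂} D] [Preadditive D] [HasZeroObject D] [HasBinaryBiproducts D]
    [Extriangulated.{w₂} D] {F : C ⥤ D} (hF : IsExactFunctor F) {X Y Z : C} {f : X ⟶ Y}
    {g : Y ⟶ Z} (h : IsConflation f g) : IsConflation (F.map f) (F.map g) := by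
  obtain ⟨-, η, -, -, hη⟩ := hF
  obtain ⟨δ, hδ⟩ := h
  exact ⟨_, hη f g δ hδ⟩

namespace Recollement

variable {A : Type u₁} [Category.{v₁} A] [Preadditive A] [HasZeroObject A] [HasBinaryBiproducts A]
  [Extriangulated.{w₁} A]
  {B : Type u₂} [Category.{v₂} B] [Preadditive B] [HasZeroObject B] [HasBinaryBiproducts B]
  [Extriangulated.{w₂} B]
  {C : Type u₃} [Category.{v₃} C] [Preadditive C] [HasZeroObject C] [HasBinaryBiproducts C]
  [Extriangulated.{w₃} C]
  (r : Recollement A B C)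

lemma isZero_jUp_iLow (X : A) : IsZero (r.jUp.obj (r.iLow.obj X)) :=
  (r.image_eq_kernel _).1 (r.iLow.obj_mem_essImage X)

lemma isZero_iShriek_jLow (Z : C) : IsZero (r.iShriek.obj (r.jLow.obj Z)) := by
  rw [IsZero.iff_id_eq_zero]
  apply (r.adjLowShriek.homEquiv _ _).symm.injective
  apply (r.adjUpLow'.homEquiv _ _).symm.injective
  exact (r.isZero_jUp_iLow _).eq_of_src _ _

lemma isZero_iUp_jShriek (Z : C) : IsZero (r.iUp.obj (r.jShriek.obj Z)) := by
  rw [IsZero.iff_id_eq_zero]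
  apply (r.adjUpLow.homEquiv _ _).injective
  apply (r.adjShriekUp.homEquiv _ _).injective
  exact (r.isZero_jUp_iLow _).eq_of_tgt _ _

lemma isIso_iUp_unit (X : B) : IsIso (r.iUp.map (r.adjUpLow.unit.app X)) := by
  have := r.iLow_full
  have := r.iLow_faithful
  rw [(IsIso.eq_comp_inv _).2 (r.adjUpLow.left_triangle_components X)]
  exact IsIso.comp_isIso' (IsIso.id _) inferInstance

lemma isIso_iShriek_counit (X : B) : IsIso (r.iShriek.map (r.adjLowShriek.counit.app X)) := by
  have := r.iLow_full
  have := r.iLow_faithful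
  rw [(IsIso.eq_inv_comp _).2 (r.adjLowShriek.right_triangle_components X)]
  exact IsIso.comp_isIso' inferInstance inferInstance

/-- The object `i^* i_* X` is isomorphic to `X`. -/
noncomputable def iUpLowIso (X : A) : r.iUp.obj (r.iLow.obj X) ≅ X :=
  have := r.iLow_full
  have := r.iLow_faithful
  asIso (r.adjUpLow.counit.app X)

/-- The object `i^! i_* X` is isomorphic to `X`. -/
noncomputable def iShriekLowIso (X : A) : r.iShriek.obj (r.iLow.obj X) ≅ X :=
  have := r.iLow_full
  have := r.iLow_faithful
  (asIso (r.adjLowShriek.unit.app X)).symm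

/-- The object `j^* j_* Z` is isomorphic to `Z`. -/
noncomputable def jUpLowIso (Z : C) : r.jUp.obj (r.jLow.obj Z) ≅ Z :=
  have := r.jLow_full
  have := r.jLow_faithful
  asIso (r.adjUpLow'.counit.app Z)

section

variable [NegativeFirstExtensions A]

/-- If `i^!` is exact, the four-term left exact sequence of `X` is a conflation: applying `i^!`
to its two halves shows that the fourth term is zero. -/
lemma isConflation_counit_unit (hi' : IsExactFunctor r.iShriek) (X : B) :
    IsConflation (r.adjLowShriek.counit.app X) (r.adjUpLow'.unit.app X) := by
  obtain ⟨Y, h, K, g₁, g₂, h₁, h₂, -, hg⟩ := r.left_seq X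
  have := hi'.1
  have := r.iLow_exact.1
  have := r.isIso_iShriek_counit X
  have hK : IsZero (r.iShriek.obj K) := (hi'.map_isConflation h₁).isZero_of_isIso_left
  have hY : IsZero Y := ((hi'.map_isConflation h₂).isZero_right hK
    (r.isZero_iShriek_jLow _)).of_iso (r.iShriekLowIso Y).symm
  have := h₂.isIso_of_isZero_right (r.iLow.map_isZero hY)
  simpa [hg] using h₁.iso_comp (Iso.refl _) (asIso g₂)

/-- If `i^*` is exact, the four-term right exact sequence of `X` is a conflation: applying `i^*`
to its two halves shows that the first term is zero. -/
lemma isConflation_counit_unit' (hi : IsExactFunctor r.iUp) (X : B) :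
    IsConflation (r.adjShriekUp.counit.app X) (r.adjUpLow.unit.app X) := by
  obtain ⟨Y, h, K, g₁, g₂, h₁, h₂, -, hg⟩ := r.right_seq X
  have := hi.1
  have := r.iLow_exact.1
  have := r.isIso_iUp_unit X
  have hK : IsZero (r.iUp.obj K) := (hi.map_isConflation h₂).isZero_of_isIso_right
  have hY : IsZero Y := ((hi.map_isConflation h₁).isZero_left
    (r.isZero_iUp_jShriek _) hK).of_iso (r.iUpLowIso Y).symm
  have := h₁.isIso_of_isZero_left (r.iLow.map_isZero hY)
  simpa [hg] using h₂.iso_comp (asIso g₁) (Iso.refl _)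

end

/-- A morphism into `Y` that is killed by `j^*` factors through `i_* i^! Y ⟶ Y`. -/
lemma exists_comp_counit_eq [NegativeFirstExtensions A] (hi' : IsExactFunctor r.iShriek)
    {X Y : B} (t : X ⟶ Y) (ht : r.jUp.map t = 0) :
    ∃ s : r.iUp.obj X ⟶ r.iShriek.obj Y,
      r.adjUpLow.unit.app X ≫ r.iLow.map s ≫ r.adjLowShriek.counit.app Y = t := by
  have h : t ≫ r.adjUpLow'.unit.app Y = 0 := by
    have := r.jLow_leftExact.additive
    have := r.adjUpLow'.unit.naturality t
    simpa [ht] using this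
  obtain ⟨a, ha⟩ := (r.isConflation_counit_unit hi' Y).exists_lift t h
  have h' : r.adjUpLow.unit.app X ≫ r.iLow.map ((r.adjUpLow.homEquiv X _).symm a) = a :=
    (r.adjUpLow.homEquiv_unit ..).symm.trans (Equiv.apply_symm_apply _ a)
  refine ⟨(r.adjUpLow.homEquiv _ _).symm a, ?_⟩
  rw [← ha]
  exact (Category.assoc _ _ _).symm.trans (congrArg (· ≫ r.adjLowShriek.counit.app Y) h')

/-- The composite `X ⟶ i_* i^* X ⟶ i_* i^! P ⟶ P` determines the morphism `i^* X ⟶ i^! P` when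
`P` is projective, since `E⁻¹(j_! j^* X, P) = 0`. -/
lemma eq_zero_of_isProj [NegativeFirstExtensions A] [NegativeFirstExtensions B]
    (hB : IsBalanced B) (hi : IsExactFunctor r.iUp) {X P : B} (hP : IsProj P)
    (s : r.iUp.obj X ⟶ r.iShriek.obj P)
    (hs : r.adjUpLow.unit.app X ≫ r.iLow.map s ≫ r.adjLowShriek.counit.app P = 0) : s = 0 := by
  obtain ⟨δ, hδ⟩ := r.isConflation_counit_unit' hi X
  obtain ⟨ξ, hξ⟩ := ((NegativeFirstExtensions.exact_upper _ _ _ hδ P).2.2 _).1 hs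
  have := r.iLow_exact.1
  apply (r.adjLowShriek.homEquiv _ _).symm.injective
  rw [r.adjLowShriek.homEquiv_counit, r.adjLowShriek.homEquiv_counit, ← hξ, hB _ _ hP ξ]
  simp

/-- The gluing of orthogonality. For the negative extensions, `E⁻¹(X, Y)` is embedded into
`B(X, K)` by a conflation `K ⟶ P ⟶ Y` with `P` projective. -/
lemma objOrthogonal [NegativeFirstExtensions A] [NegativeFirstExtensions B]
    [NegativeFirstExtensions C] (hB : IsBalanced B) (hproj : HasEnoughProj B)
    (hi : IsExactFunctor r.iUp) (hi' : IsExactFunctor r.iShriek) {X Y : B}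
    (h₁ : ObjOrthogonal (r.iUp.obj X) (r.iShriek.obj Y))
    (h₂ : ObjOrthogonal (r.jUp.obj X) (r.jUp.obj Y)) : ObjOrthogonal X Y := by
  have := r.iLow_exact.1
  constructor
  · intro t
    obtain ⟨s, rfl⟩ := r.exists_comp_counit_eq hi' t (h₂.1 _)
    simp [h₁.1 s]
  · intro ξ
    obtain ⟨K, P, x, y, hxy, hP⟩ := hproj Y
    obtain ⟨δ, hδ⟩ := id hxy
    obtain ⟨-, hl₁, hl₂⟩ := NegativeFirstExtensions.exact_lower _ _ _ hδ X
    set t := NegativeFirstExtensions.lower δ X ξ with ht_def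
    have htx : t ≫ x = 0 := (hl₂ t).2 ⟨ξ, rfl⟩
    -- The map `E⁻¹(X, Y) ⟶ B(X, K)` is injective, as `E⁻¹(X, P) = 0`.
    suffices ht : t = 0 by
      obtain ⟨ζ, rfl⟩ := (hl₁ ξ).1 (ht_def.symm.trans ht)
      rw [hB _ _ hP ζ, map_zero]
    -- `j^* t` is killed by `j^* K ⟶ j^* P`, hence comes from `E⁻¹(j^* X, j^* Y) = 0`.
    have hjt : r.jUp.map t = 0 := by
      have := r.jUp_exact.1
      obtain ⟨δ', hδ'⟩ := r.jUp_exact.map_isConflation hxy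
      obtain ⟨ζ, hζ⟩ := ((NegativeFirstExtensions.exact_lower _ _ _ hδ'
        (r.jUp.obj X)).2.2 (r.jUp.map t)).1 (by simp [← Functor.map_comp, htx])
      rw [← hζ, h₂.2 ζ, map_zero]
    -- So `t` is induced by a morphism `s : i^* X ⟶ i^! K`; it is killed by `i^! K ⟶ i^! P`, hence
    -- comes from `E⁻¹(i^* X, i^! Y) = 0`.
    obtain ⟨s, hs⟩ := r.exists_comp_counit_eq hi' t hjt
    have hsx : s ≫ r.iShriek.map x = 0 := by
      apply r.eq_zero_of_isProj hB hi hP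
      have := r.adjLowShriek.counit.naturality x
      simp only [Functor.comp_map, Functor.id_map] at this
      rw [Functor.map_comp, Category.assoc, this, ← htx, ← hs]
      simp
    obtain ⟨δ', hδ'⟩ := hi'.map_isConflation hxy
    obtain ⟨ζ, hζ⟩ := ((NegativeFirstExtensions.exact_lower _ _ _ hδ'
        (r.iUp.obj X)).2.2 s).1 hsx
    rw [← hs, ← hζ, h₁.2 ζ]
    simp

/-- The inflation part of the image under `j_*` of a conflation `U ⟶ Y ⟶ V`: its cone need not
be `j_* V`, but is killed by `i^!` and mapped to a cone of `U ⟶ Y` by `j^*`. -/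
lemma exists_isConflation_jLow [NegativeFirstExtensions A]
    (hi' : IsExactFunctor r.iShriek) {U Y V : C} {x : U ⟶ Y} {y : Y ⟶ V}
    (h : IsConflation x y) :
    ∃ (K : B) (g : r.jLow.obj Y ⟶ K), IsConflation (r.jLow.map x) g ∧
      IsZero (r.iShriek.obj K) ∧ Nonempty (r.jUp.obj K ≅ V) := by
  have hV : IsConflation (𝟙 V) (0 : V ⟶ 0) := ⟨_, isTriangle_id_left V (isZero_zero C)⟩
  obtain ⟨K, g₁, g₂, h₁, -⟩ := r.jLow_leftExact.map_leftExact x y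
    ⟨V, y, 𝟙 V, h, ⟨_, _, hV⟩, fun _ _ => inferInstance, by simp⟩
  refine ⟨K, g₁, h₁, (hi'.map_isConflation h₁).isZero_right (r.isZero_iShriek_jLow _)
    (r.isZero_iShriek_jLow _), ?_⟩
  have := r.jLow_full
  have := r.jLow_faithful
  -- Up to `j^* j_* ≅ 1`, both `j^* K` and `V` are cones of `x`.
  have h₂ := (r.jUp_exact.map_isConflation h₁).iso_comp (r.jUpLowIso U).symm (Iso.refl _)
  have h₃ := h.comp_middle_iso (r.jUpLowIso Y).symm
  have hx : (r.jUpLowIso U).symm.hom ≫ r.jUp.map (r.jLow.map x) =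
      x ≫ (r.jUpLowIso Y).symm.hom := by
    simp [jUpLowIso]
  rw [hx] at h₂
  exact h₂.nonempty_cone_iso h₃

/-- The gluing of torsion decompositions. The object `Y` is the cocone of `X ⟶ j_* j^* X ⟶ K`, where
`K` stands in for `j_* V₂`; the torsion part `T` is the cocone of `Y ⟶ i_* i^* Y ⟶ i_* V₁`, and the
torsion-free part `F` is an extension of `K` by `i_* V₁`. -/
lemma exists_isConflation [NegativeFirstExtensions A]
    (hi : IsExactFunctor r.iUp) (hi' : IsExactFunctor r.iShriek)
    {T₁ F₁ : ObjectProperty A} {T₂ F₂ : ObjectProperty C}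
    [T₁.IsClosedUnderIsomorphisms] [F₁.IsClosedUnderIsomorphisms]
    [T₂.IsClosedUnderIsomorphisms] [F₂.IsClosedUnderIsomorphisms]
    (h₁ : ∀ X : A, ∃ (U V : A) (x : U ⟶ X) (y : X ⟶ V), IsConflation x y ∧ T₁ U ∧ F₁ V)
    (h₂ : ∀ X : C, ∃ (U V : C) (x : U ⟶ X) (y : X ⟶ V), IsConflation x y ∧ T₂ U ∧ F₂ V)
    (X : B) :
    ∃ (U V : B) (x : U ⟶ X) (y : X ⟶ V), IsConflation x y ∧
      (T₁ (r.iUp.obj U) ∧ T₂ (r.jUp.obj U)) ∧ F₁ (r.iShriek.obj V) ∧ F₂ (r.jUp.obj V) := by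
  obtain ⟨U₂, V₂, x₂, y₂, hxy₂, hU₂, hV₂⟩ := h₂ (r.jUp.obj X)
  obtain ⟨K, g, ⟨ε, hε⟩, hK, ⟨eK⟩⟩ := r.exists_isConflation_jLow hi' hxy₂
  obtain ⟨δ, hδ⟩ := r.isConflation_counit_unit hi' X
  obtain ⟨Y, p, d, e, δY, hY, -, -, hY', -⟩ := Extriangulated.et4op _ _ _ _ _ _ hδ hε
  obtain ⟨U₁, V₁, x₁, y₁, hxy₁, hU₁, hV₁⟩ := h₁ (r.iUp.obj Y)
  obtain ⟨δ', hδ'⟩ := r.isConflation_counit_unit' hi Y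
  obtain ⟨ε', hε'⟩ := r.iLow_exact.map_isConflation hxy₁
  obtain ⟨T, q, d', e', δT, hT, -, -, hT', -⟩ := Extriangulated.et4op _ _ _ _ _ _ hδ' hε'
  obtain ⟨F, h', d'', e'', δF, hF, -, -, hF', -⟩ := Extriangulated.et4 _ _ _ _ _ _ hT hY
  refine ⟨T, F, q ≫ p, h', ⟨_, hF⟩, ⟨?_, ?_⟩, ?_, ?_⟩
  · have := (hi.map_isConflation ⟨_, hT'⟩).isIso_of_isZero_left (r.isZero_iUp_jShriek _)
    exact T₁.prop_of_iso (asIso (r.iUp.map e') ≪≫ r.iUpLowIso U₁).symm hU₁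
  · have := (r.jUp_exact.map_isConflation ⟨_, hT⟩).isIso_of_isZero_right (r.isZero_jUp_iLow _)
    have := (r.jUp_exact.map_isConflation ⟨_, hY'⟩).isIso_of_isZero_left (r.isZero_jUp_iLow _)
    exact T₂.prop_of_iso (asIso (r.jUp.map q) ≪≫ asIso (r.jUp.map e) ≪≫ r.jUpLowIso U₂).symm hU₂
  · have := (hi'.map_isConflation ⟨_, hF'⟩).isIso_of_isZero_right hK
    exact F₁.prop_of_iso ((r.iShriekLowIso V₁).symm ≪≫ asIso (r.iShriek.map d'')) hV₁
  · have := (r.jUp_exact.map_isConflation ⟨_, hF'⟩).isIso_of_isZero_left (r.isZero_jUp_iLow _)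
    exact F₂.prop_of_iso (asIso (r.jUp.map e'') ≪≫ eK).symm hV₂

end Recollement

end Recollements

end Extri

universe z₁ w₁ v₁ u₁ z₂ w₂ v₂ u₂ z₃ w₃ v₃ u₃

theorem theorem4p5
    {A : Type u₁} [Category.{v₁} A] [Preadditive A] [HasZeroObject A] [HasBinaryBiproducts A]
    [Extriangulated.{w₁} A] [NegativeFirstExtensions.{z₁} A]
    {B : Type u₂} [Category.{v₂} B] [Preadditive B] [HasZeroObject B] [HasBinaryBiproducts B]
    [Extriangulated.{w₂} B] [NegativeFirstExtensions.{z₂} B]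
    {C : Type u₃} [Category.{v₃} C] [Preadditive C] [HasZeroObject C] [HasBinaryBiproducts C]
    [Extriangulated.{w₃} C] [NegativeFirstExtensions.{z₃} C]
    (hA : IsBalanced A) (hB : IsBalanced B) (hC : IsBalanced C)
    (hproj : HasEnoughProj B)
    (r : Recollement A B C)
    (hi : IsExactFunctor r.iUp) (hi' : IsExactFunctor r.iShriek)
    (hP : PreservesProj r.iShriek)
    (E₁ M₁ : MorphismProperty A) (h₁ : IsInflationFactorizationSystem E₁ M₁)
    (E₂ M₂ : MorphismProperty C) (h₂ : IsInflationFactorizationSystem E₂ M₂) :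
    IsInflationFactorizationSystem (r.glueLeft E₁ E₂) (r.glueRight M₁ M₂) := by
  have t₁ := h₁.isTorsionPair
  have t₂ := h₂.isTorsionPair
  have t : IsTorsionPair (C := B)
      (fun X => coneClass E₁ (r.iUp.obj X) ∧ coneClass E₂ (r.jUp.obj X))
      (fun X => coneClass M₁ (r.iShriek.obj X) ∧ coneClass M₂ (r.jUp.obj X)) :=
    { left_iso := ⟨fun e h => ⟨ObjectProperty.prop_of_iso _ (r.iUp.mapIso e) h.1,
        ObjectProperty.prop_of_iso _ (r.jUp.mapIso e) h.2⟩⟩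
      right_iso := ⟨fun e h => ⟨ObjectProperty.prop_of_iso _ (r.iShriek.mapIso e) h.1,
        ObjectProperty.prop_of_iso _ (r.jUp.mapIso e) h.2⟩⟩
      orthogonal := fun hX hY => r.objOrthogonal hB hproj hi hi' (t₁.orthogonal hX.1 hY.1)
        (t₂.orthogonal hX.2 hY.2)
      exists_conflation := r.exists_isConflation hi hi' t₁.exists_conflation
        t₂.exists_conflation }
  refine t.isInflationFactorizationSystem ?_ ?_ (fun _ h => h.1) (fun _ h => h.1)
  · intro X Y Z f y hf
    rw [← h₁.left_iff (hi.map_isConflation hf), ← h₂.left_iff (r.jUp_exact.map_isConflation hf)]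
    exact ⟨fun h => h.2, fun h => ⟨⟨_, _, hf⟩, h⟩⟩
  · intro X Y Z f y hf
    rw [← h₁.right_iff (hi'.map_isConflation hf), ← h₂.right_iff (r.jUp_exact.map_isConflation hf)]
    exact ⟨fun h => h.2, fun h => ⟨⟨_, _, hf⟩, h⟩⟩
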